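/- For a countable ordinal $\alpha$ let $\{e_\beta:\beta\le\alpha\}$ be the canonical orthonormal basis of the complex Hilbert space $\ell_2$ indexed by the ordinals $\beta\le\alpha$, let $N_\beta=\overline{\operatorname{span}}\{e_\gamma:\gamma\le\beta\}$ for $\beta\le\alpha$, and let $\mathbf T^1(\alpha)$ be the associated nest algebra in the trace class: the space of all bounded operators $T$ with $TN_\beta\subseteq N_\beta$ for every $\beta\le\alpha$ and $\|T\|_1=\operatorname{tr}\big((T^*T)^{1/2}\big)<\infty$, normed by $\|\cdot\|_1$. If $\alpha,\beta$ are countable ordinals with $\omega^2\le\alpha\le\beta<\alpha^\omega$ (ordinal exponentiation), then $\mathbf T^1(\alpha)\approx\mathbf T^1(\beta)$, that is, there is a linear homeomorphism of $\mathbf T^1(\alpha)$ onto $\mathbf T^1(\beta)$. -/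

import Mathlib

open scoped ENNReal InnerProductSpace Ordinal

namespace NestC1

section TraceClass

variable {ι : Type*} {H : Type*} [NormedAddCommGroup H] [InnerProductSpace ℂ H] [CompleteSpace H]

/-- The trace norm `‖T‖₁ = tr (T* T)^{1/2}` of a bounded operator `T`, with values in `[0, ∞]`.
The trace of the positive operator `|T| = (T* T)^{1/2}` is the sum of its diagonal entries
`⟨e i, |T| (e i)⟩ ≥ 0` in the orthonormal basis `e`. -/
noncomputable def traceNorm (e : HilbertBasis ι ℂ H) (T : H →L[ℂ] H) : ℝ≥0∞ :=
  ∑' i, ENNReal.ofReal (⟪e i, CFC.abs T (e i)⟫_ℂ).re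

/-! ### The trace norm is a norm -/

theorem tsum_enorm_inner_sq (e : HilbertBasis ι ℂ H) (x : H) :
    ∑' i, ‖⟪e i, x⟫_ℂ‖ₑ ^ 2 = ‖x‖ₑ ^ 2 := by
  have h1 := e.hasSum_inner_mul_inner x x
  have h2 := Complex.hasSum_re h1
  have h3 : ∀ i, (⟪x, e i⟫_ℂ * ⟪e i, x⟫_ℂ).re = ‖⟪e i, x⟫_ℂ‖ ^ 2 := by
    intro i
    rw [← inner_conj_symm x (e i), Complex.conj_mul']
    norm_cast
  simp only [h3] at h2
  have h4 : (⟪x, x⟫_ℂ).re = ‖x‖ ^ 2 := by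
    rw [inner_self_eq_norm_sq_to_K]; norm_cast
  rw [h4] at h2
  have h5 := ENNReal.ofReal_tsum_of_nonneg (fun i => sq_nonneg ‖⟪e i, x⟫_ℂ‖) h2.summable
  rw [h2.tsum_eq] at h5
  simp only [ENNReal.ofReal_pow (norm_nonneg _), ofReal_norm] at h5
  exact h5.symm

theorem tsum_enorm_adjoint_sq (e : HilbertBasis ι ℂ H) (A : H →L[ℂ] H) :
    ∑' i, ‖(star A) (e i)‖ₑ ^ 2 = ∑' i, ‖A (e i)‖ₑ ^ 2 := by
  simp only [← tsum_enorm_inner_sq e]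
  rw [ENNReal.tsum_comm]
  refine tsum_congr fun i => tsum_congr fun j => ?_
  rw [ContinuousLinearMap.star_eq_adjoint, ContinuousLinearMap.adjoint_inner_right,
    ← inner_conj_symm, ← ofReal_norm, ← ofReal_norm, RCLike.norm_conj]

theorem inner_sqrt {P : H →L[ℂ] H} (hP : 0 ≤ P) (x y : H) :
    ⟪CFC.sqrt P x, CFC.sqrt P y⟫_ℂ = ⟪x, P y⟫_ℂ := by
  have h : IsSelfAdjoint (CFC.sqrt P) := (CFC.sqrt_nonneg P).isSelfAdjoint
  rw [← ContinuousLinearMap.adjoint_inner_right, ← ContinuousLinearMap.star_eq_adjoint, h.star_eq,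
    ← mul_apply_eq_comp, CFC.sqrt_mul_sqrt_self P hP]

theorem trace_eq_sqrt (e : HilbertBasis ι ℂ H) {P : H →L[ℂ] H} (hP : 0 ≤ P) :
    ∑' i, ENNReal.ofReal (⟪e i, P (e i)⟫_ℂ).re = ∑' i, ‖CFC.sqrt P (e i)‖ₑ ^ 2 := by
  refine tsum_congr fun i => ?_
  rw [← inner_sqrt hP, inner_self_eq_norm_sq_to_K, ← ofReal_norm,
    ← ENNReal.ofReal_pow (norm_nonneg _)]
  norm_cast

theorem exists_contraction {A B : H →L[ℂ] H} (h : ∀ x, ‖B x‖ ≤ ‖A x‖) :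
    ∃ C : H →L[ℂ] H, ‖C‖ ≤ 1 ∧ C * A = B := by
  let K : Submodule ℂ H := (LinearMap.range (A : H →ₗ[ℂ] H)).topologicalClosure
  have : CompleteSpace K :=
    (Submodule.isClosed_topologicalClosure _).completeSpace_coe
  have hmem : ∀ x, (A : H →ₗ[ℂ] H) x ∈ K := fun x =>
    Submodule.le_topologicalClosure _ (LinearMap.mem_range_self _ x)
  let a : H →ₗ[ℂ] K := (A : H →ₗ[ℂ] H).codRestrict K hmem
  have hd : DenseRange a := by
    intro x
    rw [closure_subtype]
    have hx : (x : H) ∈ closure (LinearMap.range (A : H →ₗ[ℂ] H) : Set H) := x.2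
    refine closure_mono ?_ hx
    rintro _ ⟨y, rfl⟩
    exact ⟨a y, ⟨y, rfl⟩, rfl⟩
  have hb : ∀ x, ‖(B : H →ₗ[ℂ] H) x‖ ≤ 1 * ‖a x‖ := by
    intro x; rw [one_mul]; exact h x
  refine ⟨((B : H →ₗ[ℂ] H).extendOfNorm a) ∘L K.orthogonalProjectionOnto, ?_, ?_⟩
  · refine ContinuousLinearMap.opNorm_le_bound _ zero_le_one fun x => ?_
    rw [ContinuousLinearMap.comp_apply]
    refine (LinearMap.norm_extendOfNorm_apply_le hd 1 hb _).trans ?_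
    gcongr
    exact Submodule.norm_orthogonalProjectionOnto_apply_le K x
  · ext x
    have h1 : K.orthogonalProjectionOnto (A x) = a x :=
      Submodule.orthogonalProjectionOnto_mem_subspace_eq_self (a x)
    rw [mul_apply_eq_comp, ContinuousLinearMap.comp_apply, h1,
      LinearMap.extendOfNorm_eq hd ⟨1, hb⟩]
    rfl

theorem norm_abs_apply (T : H →L[ℂ] H) (x : H) : ‖CFC.abs T x‖ = ‖T x‖ := by
  have h : IsSelfAdjoint (CFC.abs T) := (CFC.abs_nonneg T).isSelfAdjoint
  have h1 : ⟪CFC.abs T x, CFC.abs T x⟫_ℂ = ⟪T x, T x⟫_ℂ := by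
    rw [← ContinuousLinearMap.adjoint_inner_right, ← ContinuousLinearMap.star_eq_adjoint,
      h.star_eq, ← mul_apply_eq_comp, CFC.abs_mul_abs, mul_apply_eq_comp,
      ContinuousLinearMap.star_eq_adjoint, ContinuousLinearMap.adjoint_inner_right]
  rw [inner_self_eq_norm_sq_to_K, inner_self_eq_norm_sq_to_K] at h1
  have h2 : ‖CFC.abs T x‖ ^ 2 = ‖T x‖ ^ 2 := by exact_mod_cast h1
  exact (sq_eq_sq₀ (norm_nonneg _) (norm_nonneg _)).1 h2

theorem tsum_enorm_inner_mul_le (e : HilbertBasis ι ℂ H) {C P : H →L[ℂ] H} (hC : ‖C‖ ≤ 1)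
    (hP : 0 ≤ P) :
    ∑' i, ‖⟪e i, C (P (e i))⟫_ℂ‖ₑ ≤ ∑' i, ENNReal.ofReal (⟪e i, P (e i)⟫_ℂ).re := by
  rw [trace_eq_sqrt e hP]
  set S := CFC.sqrt P with hS
  have hSs : star S = S := (CFC.sqrt_nonneg P).isSelfAdjoint.star_eq
  have hCe : ‖C‖ₑ ≤ 1 := by
    rw [← ofReal_norm]; exact ENNReal.ofReal_le_one.2 hC
  have key : ∀ i, ‖⟪e i, C (P (e i))⟫_ℂ‖ₑ ≤
      2⁻¹ * (‖(S * star C) (e i)‖ₑ ^ 2 + ‖S (e i)‖ₑ ^ 2) := by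
    intro i
    have h1 : ⟪e i, C (P (e i))⟫_ℂ = ⟪(S * star C) (e i), S (e i)⟫_ℂ := by
      rw [mul_apply_eq_comp, inner_sqrt hP, ContinuousLinearMap.star_eq_adjoint,
        ContinuousLinearMap.adjoint_inner_left]
    have h2 : ‖⟪e i, C (P (e i))⟫_ℂ‖ ≤
        2⁻¹ * (‖(S * star C) (e i)‖ ^ 2 + ‖S (e i)‖ ^ 2) := by
      rw [h1]
      refine (norm_inner_le_norm _ _).trans ?_
      nlinarith [sq_nonneg (‖(S * star C) (e i)‖ - ‖S (e i)‖)]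
    have h3 := ENNReal.ofReal_le_ofReal h2
    rw [ENNReal.ofReal_mul (by norm_num), ENNReal.ofReal_add (by positivity) (by positivity),
      ENNReal.ofReal_pow (norm_nonneg _), ENNReal.ofReal_pow (norm_nonneg _),
      ENNReal.ofReal_inv_of_pos (by norm_num)] at h3
    simpa only [ofReal_norm, ENNReal.ofReal_ofNat] using h3
  have hsum : ∑' i, ‖(S * star C) (e i)‖ₑ ^ 2 ≤ ∑' i, ‖S (e i)‖ₑ ^ 2 := by
    have h4 := tsum_enorm_adjoint_sq e (S * star C)
    rw [← h4, star_mul, star_star, hSs]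
    refine ENNReal.tsum_le_tsum fun i => ?_
    rw [mul_apply_eq_comp]
    gcongr
    calc ‖C (S (e i))‖ₑ ≤ ‖C‖ₑ * ‖S (e i)‖ₑ := C.le_opENorm _
      _ ≤ 1 * ‖S (e i)‖ₑ := by gcongr
      _ = ‖S (e i)‖ₑ := one_mul _
  calc ∑' i, ‖⟪e i, C (P (e i))⟫_ℂ‖ₑ
      ≤ ∑' i, 2⁻¹ * (‖(S * star C) (e i)‖ₑ ^ 2 + ‖S (e i)‖ₑ ^ 2) := ENNReal.tsum_le_tsum key
    _ = 2⁻¹ * (∑' i, ‖(S * star C) (e i)‖ₑ ^ 2 + ∑' i, ‖S (e i)‖ₑ ^ 2) := by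
        rw [ENNReal.tsum_mul_left, ENNReal.tsum_add]
    _ ≤ 2⁻¹ * (∑' i, ‖S (e i)‖ₑ ^ 2 + ∑' i, ‖S (e i)‖ₑ ^ 2) := by gcongr
    _ = ∑' i, ‖S (e i)‖ₑ ^ 2 := by
        rw [← two_mul, ← mul_assoc, ENNReal.inv_mul_cancel two_ne_zero ENNReal.ofNat_ne_top,
          one_mul]

theorem tsum_enorm_inner_le_traceNorm (e : HilbertBasis ι ℂ H) {C : H →L[ℂ] H} (hC : ‖C‖ ≤ 1)
    (T : H →L[ℂ] H) : ∑' i, ‖⟪e i, C (T (e i))⟫_ℂ‖ₑ ≤ traceNorm e T := by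
  obtain ⟨V, hV, hVT⟩ := exists_contraction (A := CFC.abs T) (B := T)
    fun x => (norm_abs_apply T x).ge
  have hCV : ‖C * V‖ ≤ 1 := (norm_mul_le _ _).trans (mul_le_one₀ hC (norm_nonneg _) hV)
  have h := tsum_enorm_inner_mul_le e hCV (CFC.abs_nonneg T)
  have h2 : ∀ x, (C * V) (CFC.abs T x) = C (T x) := by
    intro x
    conv_rhs => rw [← hVT]
    rfl
  simpa only [h2, traceNorm] using h

theorem traceNorm_add_le (e : HilbertBasis ι ℂ H) (S T : H →L[ℂ] H) :
    traceNorm e (S + T) ≤ traceNorm e S + traceNorm e T := by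
  obtain ⟨W, hW, hWT⟩ := exists_contraction (A := S + T) (B := CFC.abs (S + T))
    fun x => (norm_abs_apply (S + T) x).le
  calc traceNorm e (S + T)
      ≤ ∑' i, (‖⟪e i, W (S (e i))⟫_ℂ‖ₑ + ‖⟪e i, W (T (e i))⟫_ℂ‖ₑ) := by
        refine ENNReal.tsum_le_tsum fun i => ?_
        have h : ⟪e i, CFC.abs (S + T) (e i)⟫_ℂ
            = ⟪e i, W (S (e i))⟫_ℂ + ⟪e i, W (T (e i))⟫_ℂ := by
          rw [← hWT, mul_apply_eq_comp, add_apply, map_add,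
            inner_add_right]
        rw [h]
        refine le_trans ?_ (enorm_add_le _ _)
        rw [← ofReal_norm]
        exact ENNReal.ofReal_le_ofReal (Complex.re_le_norm _)
    _ ≤ traceNorm e S + traceNorm e T := by
        rw [ENNReal.tsum_add]
        exact add_le_add (tsum_enorm_inner_le_traceNorm e hW S)
          (tsum_enorm_inner_le_traceNorm e hW T)

theorem traceNorm_smul (e : HilbertBasis ι ℂ H) (c : ℂ) (T : H →L[ℂ] H) :
    traceNorm e (c • T) = ‖c‖ₑ * traceNorm e T := by
  unfold traceNorm
  rw [← ENNReal.tsum_mul_left]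
  refine tsum_congr fun i => ?_
  have h1 : (⟪e i, CFC.abs (c • T) (e i)⟫_ℂ).re = ‖c‖ * (⟪e i, CFC.abs T (e i)⟫_ℂ).re := by
    rw [CFC.abs_smul, smul_apply, inner_smul_right_eq_smul, Complex.smul_re,
      smul_eq_mul]
  rw [h1, ENNReal.ofReal_mul (norm_nonneg _), ofReal_norm]

theorem traceNorm_zero (e : HilbertBasis ι ℂ H) : traceNorm e (0 : H →L[ℂ] H) = 0 := by
  simp [traceNorm]

theorem eq_zero_of_traceNorm_eq_zero (e : HilbertBasis ι ℂ H) {T : H →L[ℂ] H}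
    (h : traceNorm e T = 0) : T = 0 := by
  have h0 := CFC.abs_nonneg T
  rw [traceNorm, trace_eq_sqrt e h0, ENNReal.tsum_eq_zero] at h
  have h1 : ∀ i, CFC.sqrt (CFC.abs T) (e i) = 0 := by
    intro i
    simpa using h i
  have h2 : CFC.sqrt (CFC.abs T) = 0 := by
    refine ContinuousLinearMap.ext_on (s := Set.range e) ?_ ?_
    · rw [Submodule.dense_iff_topologicalClosure_eq_top]
      exact e.dense_span
    · rintro _ ⟨i, rfl⟩
      simpa using h1 i
  rw [← CFC.abs_eq_zero_iff, ← CFC.sqrt_mul_sqrt_self (CFC.abs T) h0, h2, zero_mul]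

/-- The trace class `c₁`: the bounded operators of finite trace norm. -/
noncomputable def traceClass (e : HilbertBasis ι ℂ H) : Submodule ℂ (H →L[ℂ] H) where
  carrier := {T | traceNorm e T < ∞}
  zero_mem' := by simp [traceNorm_zero]
  add_mem' {S T} hS hT := (traceNorm_add_le e S T).trans_lt (ENNReal.add_lt_top.2 ⟨hS, hT⟩)
  smul_mem' c T hT := by
    rw [Set.mem_ofPred_eq, traceNorm_smul]
    exact ENNReal.mul_lt_top enorm_lt_top hT

/-! ### Nest algebras in the trace class -/

variable [Preorder ι]

/-- The member `N_β = [e γ : γ ≤ β]` (closed linear span) of the nest of initial segments of an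
ordered orthonormal basis `e`. -/
noncomputable def nestSpace (e : HilbertBasis ι ℂ H) (β : ι) : Submodule ℂ H :=
  (Submodule.span ℂ (e '' Set.Iic β)).topologicalClosure

/-- The nest algebra `Alg 𝒩`: the bounded operators that leave every `N_β` invariant. -/
noncomputable def nestAlgebra (e : HilbertBasis ι ℂ H) : Submodule ℂ (H →L[ℂ] H) where
  carrier := {T | ∀ β, ∀ x ∈ nestSpace e β, T x ∈ nestSpace e β}
  zero_mem' _ _ _ := Submodule.zero_mem _
  add_mem' hS hT β x hx := Submodule.add_mem _ (hS β x hx) (hT β x hx)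
  smul_mem' c _ hT β x hx := Submodule.smul_mem _ c (hT β x hx)

/-- The nest algebra in the trace class, `(Alg 𝒩)¹ = Alg 𝒩 ∩ c₁`.
It is normed by the trace norm (not by the operator norm), see the instances below. -/
def NestAlgebraC1 (e : HilbertBasis ι ℂ H) : Type _ :=
  ↥(nestAlgebra e ⊓ traceClass e)

noncomputable instance (e : HilbertBasis ι ℂ H) : AddCommGroup (NestAlgebraC1 e) :=
  inferInstanceAs (AddCommGroup ↥(nestAlgebra e ⊓ traceClass e))

noncomputable instance (e : HilbertBasis ι ℂ H) : Module ℂ (NestAlgebraC1 e) :=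
  inferInstanceAs (Module ℂ ↥(nestAlgebra e ⊓ traceClass e))

/-- The operator underlying an element of the nest algebra in `c₁`. -/
noncomputable def NestAlgebraC1.toOp (e : HilbertBasis ι ℂ H) :
    NestAlgebraC1 e →ₗ[ℂ] (H →L[ℂ] H) :=
  (nestAlgebra e ⊓ traceClass e).subtype

theorem NestAlgebraC1.traceNorm_ne_top (e : HilbertBasis ι ℂ H) (T : NestAlgebraC1 e) :
    traceNorm e (toOp e T) ≠ ∞ :=
  ne_of_lt (Submodule.mem_inf.1 T.2).2

noncomputable instance (e : HilbertBasis ι ℂ H) : Norm (NestAlgebraC1 e) :=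
  ⟨fun T => (traceNorm e (NestAlgebraC1.toOp e T)).toReal⟩

theorem NestAlgebraC1.core (e : HilbertBasis ι ℂ H) :
    NormedSpace.Core ℂ (NestAlgebraC1 e) where
  norm_nonneg _ := ENNReal.toReal_nonneg
  norm_smul c T := by
    change (traceNorm e (toOp e (c • T))).toReal
      = ‖c‖ * (traceNorm e (toOp e T)).toReal
    rw [map_smul, traceNorm_smul, ENNReal.toReal_mul, toReal_enorm]
  norm_triangle S T := by
    change (traceNorm e (toOp e (S + T))).toReal
      ≤ (traceNorm e (toOp e S)).toReal + (traceNorm e (toOp e T)).toReal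
    rw [map_add, ← ENNReal.toReal_add (traceNorm_ne_top e S) (traceNorm_ne_top e T)]
    exact ENNReal.toReal_mono
      (ENNReal.add_ne_top.2 ⟨traceNorm_ne_top e S, traceNorm_ne_top e T⟩) (traceNorm_add_le e _ _)
  norm_eq_zero_iff T := by
    change (traceNorm e (toOp e T)).toReal = 0 ↔ T = 0
    rw [ENNReal.toReal_eq_zero_iff, or_iff_left (traceNorm_ne_top e T)]
    constructor
    · intro h
      exact Subtype.ext (eq_zero_of_traceNorm_eq_zero e h)
    · rintro rfl
      rw [map_zero, traceNorm_zero]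

noncomputable instance (e : HilbertBasis ι ℂ H) : NormedAddCommGroup (NestAlgebraC1 e) :=
  NormedAddCommGroup.ofCore (NestAlgebraC1.core e)

noncomputable instance (e : HilbertBasis ι ℂ H) : NormedSpace ℂ (NestAlgebraC1 e) :=
  NormedSpace.ofCore (NestAlgebraC1.core e)

end TraceClass

/-- The canonical orthonormal basis of `ℓ₂(ι)`. -/
noncomputable def stdBasis (ι : Type*) : HilbertBasis ι ℂ (lp (fun _ : ι => ℂ) 2) :=
  HilbertBasis.ofRepr (LinearIsometryEquiv.refl ℂ (lp (fun _ : ι => ℂ) 2))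

/-- `T¹(α)`: the nest algebra in `c₁` of the nest `N_β = [e γ : γ ≤ β]`, `β ≤ α`, where
`{e β : β ≤ α}` is the canonical basis of `ℓ₂` indexed by the ordinals `β ≤ α`. -/
abbrev T1 (α : Ordinal) : Type _ := NestAlgebraC1 (stdBasis (Set.Iic α))

end NestC1

set_option linter.unusedSectionVars false

namespace NestC1

open ContinuousLinearMap


section Trace

variable {ι κ H K : Type*} [NormedAddCommGroup H] [InnerProductSpace ℂ H] [CompleteSpace H]
  [NormedAddCommGroup K] [InnerProductSpace ℂ K] [CompleteSpace K]

/-- The square of the Hilbert–Schmidt norm of the adjoint equals that of the operator. -/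
theorem tsum_enorm_adjoint_apply_sq (e : HilbertBasis ι ℂ H) (f : HilbertBasis κ ℂ K)
    (A : H →L[ℂ] K) : ∑' j, ‖adjoint A (f j)‖ₑ ^ 2 = ∑' i, ‖A (e i)‖ₑ ^ 2 := by
  simp only [← tsum_enorm_inner_sq e, ← tsum_enorm_inner_sq f]
  rw [ENNReal.tsum_comm]
  refine tsum_congr fun i => tsum_congr fun j => ?_
  rw [adjoint_inner_right, ← inner_conj_symm, ← ofReal_norm, ← ofReal_norm, RCLike.norm_conj]

theorem enorm_inner_le (x y : K) : ‖⟪x, y⟫_ℂ‖ₑ ≤ 2⁻¹ * (‖x‖ₑ ^ 2 + ‖y‖ₑ ^ 2) := by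
  have h2 : ‖⟪x, y⟫_ℂ‖ ≤ 2⁻¹ * (‖x‖ ^ 2 + ‖y‖ ^ 2) := by
    refine (norm_inner_le_norm _ _).trans ?_
    nlinarith [sq_nonneg (‖x‖ - ‖y‖)]
  have h3 := ENNReal.ofReal_le_ofReal h2
  rw [ENNReal.ofReal_mul (by norm_num), ENNReal.ofReal_add (by positivity) (by positivity),
    ENNReal.ofReal_pow (norm_nonneg _), ENNReal.ofReal_pow (norm_nonneg _),
    ENNReal.ofReal_inv_of_pos (by norm_num)] at h3
  simpa only [ofReal_norm, ENNReal.ofReal_ofNat] using h3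

theorem tsum_enorm_contraction_comp_sq_le (e : HilbertBasis ι ℂ H) {C : K →L[ℂ] K}
    (hC : ‖C‖ ≤ 1) (A : H →L[ℂ] K) :
    ∑' i, ‖C (A (e i))‖ₑ ^ 2 ≤ ∑' i, ‖A (e i)‖ₑ ^ 2 := by
  have hCe : ‖C‖ₑ ≤ 1 := by
    rw [← ofReal_norm]; exact ENNReal.ofReal_le_one.2 hC
  refine ENNReal.tsum_le_tsum fun i => ?_
  gcongr
  calc ‖C (A (e i))‖ₑ ≤ ‖C‖ₑ * ‖A (e i)‖ₑ := C.le_opENorm _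
    _ ≤ 1 * ‖A (e i)‖ₑ := by gcongr
    _ = ‖A (e i)‖ₑ := one_mul _

theorem exists_contraction_traceNorm_le (e : HilbertBasis ι ℂ H) (T : H →L[ℂ] H) :
    ∃ W : H →L[ℂ] H, ‖W‖ ≤ 1 ∧ traceNorm e T ≤ ∑' i, ‖⟪e i, W (T (e i))⟫_ℂ‖ₑ := by
  obtain ⟨W, hW, hWT⟩ := exists_contraction (A := T) (B := CFC.abs T)
    fun x => (norm_abs_apply T x).le
  refine ⟨W, hW, ENNReal.tsum_le_tsum fun i => ?_⟩
  rw [← hWT, ← ofReal_norm]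
  exact ENNReal.ofReal_le_ofReal (Complex.re_le_norm _)

/-- A product of two Hilbert–Schmidt operators is of trace class. -/
theorem traceNorm_adjoint_comp_le (e : HilbertBasis ι ℂ H) (f : HilbertBasis κ ℂ K)
    (A B : H →L[ℂ] K) :
    traceNorm e (adjoint A ∘L B) ≤
      2⁻¹ * (∑' i, ‖A (e i)‖ₑ ^ 2 + ∑' i, ‖B (e i)‖ₑ ^ 2) := by
  obtain ⟨W, hW, hWT⟩ := exists_contraction_traceNorm_le e (adjoint A ∘L B)
  refine hWT.trans ?_
  have hsum : ∑' i, ‖A (adjoint W (e i))‖ₑ ^ 2 ≤ ∑' i, ‖A (e i)‖ₑ ^ 2 := by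
    have h1 := tsum_enorm_adjoint_apply_sq e f (A ∘L adjoint W)
    simp only [adjoint_comp, adjoint_adjoint, comp_apply] at h1
    rw [← h1, ← tsum_enorm_adjoint_apply_sq e f A]
    exact tsum_enorm_contraction_comp_sq_le f hW (adjoint A)
  calc ∑' i, ‖⟪e i, W ((adjoint A ∘L B) (e i))⟫_ℂ‖ₑ
      ≤ ∑' i, 2⁻¹ * (‖A (adjoint W (e i))‖ₑ ^ 2 + ‖B (e i)‖ₑ ^ 2) := by
        refine ENNReal.tsum_le_tsum fun i => ?_
        rw [comp_apply, ← adjoint_inner_left, adjoint_inner_right]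
        exact enorm_inner_le _ _
    _ = 2⁻¹ * (∑' i, ‖A (adjoint W (e i))‖ₑ ^ 2 + ∑' i, ‖B (e i)‖ₑ ^ 2) := by
        rw [ENNReal.tsum_mul_left, ENNReal.tsum_add]
    _ ≤ _ := by gcongr

/-- Every operator of trace class is a product of two Hilbert–Schmidt operators. -/
theorem exists_adjoint_comp_eq (e : HilbertBasis ι ℂ H) (T : H →L[ℂ] H) :
    ∃ A B : H →L[ℂ] H, T = adjoint A ∘L B ∧ ∑' i, ‖A (e i)‖ₑ ^ 2 ≤ traceNorm e T ∧
      ∑' i, ‖B (e i)‖ₑ ^ 2 ≤ traceNorm e T := by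
  obtain ⟨V, hV, hVT⟩ := exists_contraction (A := CFC.abs T) (B := T)
    fun x => (norm_abs_apply T x).ge
  have h0 := CFC.abs_nonneg T
  set S := CFC.sqrt (CFC.abs T) with hS
  have hSs : adjoint S = S := (CFC.sqrt_nonneg (CFC.abs T)).isSelfAdjoint.star_eq
  have hSS : S * S = CFC.abs T := CFC.sqrt_mul_sqrt_self _ h0
  have hB : ∑' i, ‖S (e i)‖ₑ ^ 2 = traceNorm e T := (trace_eq_sqrt e h0).symm
  refine ⟨S ∘L adjoint V, S, ?_, ?_, hB.le⟩
  · rw [adjoint_comp, adjoint_adjoint, hSs, ← hVT, ← hSS]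
    rfl
  · rw [← hB, ← tsum_enorm_adjoint_apply_sq e e (S ∘L adjoint V), adjoint_comp, adjoint_adjoint,
      hSs]
    exact tsum_enorm_contraction_comp_sq_le e hV S

theorem traceNorm_le_tsum (e : HilbertBasis ι ℂ H) {T : H →L[ℂ] H} {S : κ → H →L[ℂ] H}
    (h : ∀ i, HasSum (fun k => S k (e i)) (T (e i))) :
    traceNorm e T ≤ ∑' k, traceNorm e (S k) := by
  obtain ⟨W, hW, hWT⟩ := exists_contraction_traceNorm_le e T
  calc traceNorm e T ≤ ∑' i, ‖⟪e i, W (T (e i))⟫_ℂ‖ₑ := hWT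
    _ ≤ ∑' i, ∑' k, ‖⟪e i, W (S k (e i))⟫_ℂ‖ₑ := by
        refine ENNReal.tsum_le_tsum fun i => ?_
        have h1 := (h i).mapL ((innerSL ℂ (e i)) ∘L W)
        simp only [comp_apply, innerSL_apply_apply] at h1
        rw [← h1.tsum_eq]
        exact enorm_tsum_le_tsum_enorm
    _ = ∑' k, ∑' i, ‖⟪e i, W (S k (e i))⟫_ℂ‖ₑ := ENNReal.tsum_comm
    _ ≤ _ := ENNReal.tsum_le_tsum fun k => tsum_enorm_inner_le_traceNorm e hW (S k)

theorem enorm_apply_sq_le (e : HilbertBasis ι ℂ H) (A : H →L[ℂ] H) (x : H) :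
    ‖A x‖ₑ ^ 2 ≤ (∑' i, ‖A (e i)‖ₑ ^ 2) * ‖x‖ₑ ^ 2 := by
  rw [← tsum_enorm_inner_sq e, ← tsum_enorm_adjoint_apply_sq e e A, ← ENNReal.tsum_mul_right]
  refine ENNReal.tsum_le_tsum fun i => ?_
  rw [← adjoint_inner_left, ← mul_pow]
  gcongr
  have h := ENNReal.ofReal_le_ofReal (norm_inner_le_norm (𝕜 := ℂ) (adjoint A (e i)) x)
  rwa [ENNReal.ofReal_mul (norm_nonneg _), ofReal_norm, ofReal_norm, ofReal_norm] at h

theorem enorm_le_traceNorm (e : HilbertBasis ι ℂ H) (T : H →L[ℂ] H) :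
    ‖T‖ₑ ≤ traceNorm e T := by
  obtain ⟨A, B, hT, hA, hB⟩ := exists_adjoint_comp_eq e T
  refine opENorm_le_bound T (fun x => ?_)
  rw [← ENNReal.pow_le_pow_left_iff two_ne_zero]
  have h1 := enorm_apply_sq_le e (adjoint A) (B x)
  rw [tsum_enorm_adjoint_apply_sq e e A] at h1
  rw [hT, comp_apply, ← hT]
  calc _ ≤ _ := h1
    _ ≤ traceNorm e T * (traceNorm e T * ‖x‖ₑ ^ 2) := by
      gcongr
      exact (enorm_apply_sq_le e B x).trans (by gcongr)
    _ = _ := by ring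

/-- Operators with the same matrix are equal. -/
theorem ext_inner_basis (e : HilbertBasis ι ℂ H) {S T : H →L[ℂ] H}
    (h : ∀ i j, ⟪e i, S (e j)⟫_ℂ = ⟪e i, T (e j)⟫_ℂ) : S = T := by
  refine ContinuousLinearMap.ext_on (s := Set.range e) ?_ ?_
  · rw [Submodule.dense_iff_topologicalClosure_eq_top]
    exact e.dense_span
  · rintro _ ⟨j, rfl⟩
    apply e.repr.injective
    ext i
    rw [e.repr_apply_apply, e.repr_apply_apply, h]

/-- The operators in a nest algebra are those with upper triangular matrix. -/
theorem mem_nestAlgebra_iff [Preorder ι] (e : HilbertBasis ι ℂ H) {T : H →L[ℂ] H} :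
    T ∈ nestAlgebra e ↔ ∀ i j, ¬ i ≤ j → ⟪e i, T (e j)⟫_ℂ = 0 := by
  have hmem : ∀ {i j}, i ≤ j → e i ∈ nestSpace e j := fun {i j} h =>
    Submodule.le_topologicalClosure _ (Submodule.subset_span ⟨i, h, rfl⟩)
  have hle : ∀ {i j}, i ≤ j → nestSpace e i ≤ nestSpace e j := fun {i j} h =>
    Submodule.topologicalClosure_mono
      (Submodule.span_mono (Set.image_mono (Set.Iic_subset_Iic.2 h)))
  constructor
  · intro hT i j hij
    have h1 : nestSpace e j ≤ (innerSL ℂ (e i)).ker := by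
      refine Submodule.topologicalClosure_minimal _ ?_ (innerSL ℂ (e i)).isClosed_ker
      rw [Submodule.span_le]
      rintro _ ⟨k, hk, rfl⟩
      have : i ≠ k := by rintro rfl; exact hij hk
      simpa using e.orthonormal.2 this
    simpa using h1 (hT j _ (hmem le_rfl))
  · intro h j
    have h1 : ∀ k, T (e k) ∈ nestSpace e k := by
      intro k
      refine (Submodule.isClosed_topologicalClosure _).mem_of_tendsto (e.hasSum_repr (T (e k)))
        (Filter.Eventually.of_forall fun s => ?_)
      refine Submodule.sum_mem _ fun i _ => ?_
      by_cases hik : i ≤ k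
      · exact Submodule.smul_mem _ _ (hmem hik)
      · rw [e.repr_apply_apply, h i k hik, zero_smul]
        exact Submodule.zero_mem _
    have h2 : nestSpace e j ≤ (nestSpace e j).comap (T : H →ₗ[ℂ] H) := by
      refine Submodule.topologicalClosure_minimal _ ?_
        ((Submodule.isClosed_topologicalClosure _).preimage T.continuous)
      rw [Submodule.span_le]
      rintro _ ⟨k, hk, rfl⟩
      exact hle hk (h1 k)
    exact fun x hx => h2 hx

/-! ### Coordinate isometries -/

/-- The isometry that maps the basis vector `e i` to `f (φ i)`. -/
noncomputable def coordIsometry (e : HilbertBasis ι ℂ H) (f : HilbertBasis κ ℂ K) (φ : ι ↪ κ) :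
    H →L[ℂ] K :=
  ((f.orthonormal.comp φ φ.injective).orthogonalFamily.linearIsometry.comp
    e.repr.toLinearIsometry).toContinuousLinearMap

variable (e : HilbertBasis ι ℂ H) (f : HilbertBasis κ ℂ K) (φ : ι ↪ κ)

theorem coordIsometry_apply_basis (i : ι) : coordIsometry e f φ (e i) = f (φ i) := by
  classical
  simp [coordIsometry, e.repr_self, OrthogonalFamily.linearIsometry_apply_single]

theorem norm_coordIsometry_apply (x : H) : ‖coordIsometry e f φ x‖ = ‖x‖ := by
  simp [coordIsometry]

theorem adjoint_coordIsometry_apply_basis (i : ι) :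
    adjoint (coordIsometry e f φ) (f (φ i)) = e i := by
  classical
  apply e.repr.injective
  ext j
  rw [e.repr_apply_apply, e.repr_apply_apply, adjoint_inner_right, coordIsometry_apply_basis,
    orthonormal_iff_ite.1 f.orthonormal, orthonormal_iff_ite.1 e.orthonormal]
  simp

theorem adjoint_coordIsometry_apply_basis_of_notMem {k : κ} (hk : k ∉ Set.range φ) :
    adjoint (coordIsometry e f φ) (f k) = 0 := by
  apply e.repr.injective
  ext j
  rw [e.repr_apply_apply, adjoint_inner_right, coordIsometry_apply_basis,
    f.orthonormal.2 (fun h => hk ⟨j, h⟩)]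
  simp

/-- The compression of an operator to the coordinates in the range of `φ`. -/
noncomputable def pullOp : (K →L[ℂ] K) →ₗ[ℂ] (H →L[ℂ] H) where
  toFun T := adjoint (coordIsometry e f φ) ∘L T ∘L coordIsometry e f φ
  map_add' S T := by simp [add_comp, comp_add]
  map_smul' c T := by simp

/-- The operator that acts as the given one on the coordinates in the range of `φ`, and as zero on
the others. -/
noncomputable def pushOp : (H →L[ℂ] H) →ₗ[ℂ] (K →L[ℂ] K) where
  toFun T := coordIsometry e f φ ∘L T ∘L adjoint (coordIsometry e f φ)
  map_add' S T := by simp [add_comp, comp_add]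
  map_smul' c T := by simp

theorem inner_pullOp (T : K →L[ℂ] K) (i j : ι) :
    ⟪e i, pullOp e f φ T (e j)⟫_ℂ = ⟪f (φ i), T (f (φ j))⟫_ℂ := by
  simp [pullOp, adjoint_inner_right, coordIsometry_apply_basis]

theorem inner_pushOp (T : H →L[ℂ] H) (i j : ι) :
    ⟪f (φ i), pushOp e f φ T (f (φ j))⟫_ℂ = ⟪e i, T (e j)⟫_ℂ := by
  simp [pushOp, ← adjoint_inner_left, adjoint_coordIsometry_apply_basis]

theorem inner_pushOp_of_notMem (T : H →L[ℂ] H) {a b : κ}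
    (h : a ∉ Set.range φ ∨ b ∉ Set.range φ) : ⟪f a, pushOp e f φ T (f b)⟫_ℂ = 0 := by
  rcases h with h | h <;>
  simp [pushOp, ← adjoint_inner_left, adjoint_coordIsometry_apply_basis_of_notMem e f φ h]

theorem traceNorm_pushOp_le (T : H →L[ℂ] H) : traceNorm f (pushOp e f φ T) ≤ traceNorm e T := by
  obtain ⟨A, B, hT, hA, hB⟩ := exists_adjoint_comp_eq e T
  have hV : ∀ x, ‖coordIsometry e f φ x‖ₑ = ‖x‖ₑ := fun x => by
    rw [← ofReal_norm, norm_coordIsometry_apply, ofReal_norm]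
  have key : ∀ A : H →L[ℂ] H, ∑' j, ‖(A ∘L adjoint (coordIsometry e f φ)) (f j)‖ₑ ^ 2 =
      ∑' i, ‖A (e i)‖ₑ ^ 2 := by
    intro A
    rw [← tsum_enorm_adjoint_apply_sq f e, adjoint_comp, adjoint_adjoint,
      ← tsum_enorm_adjoint_apply_sq e e A]
    simp only [comp_apply, hV]
  have h1 : pushOp e f φ T = adjoint (A ∘L adjoint (coordIsometry e f φ)) ∘L
      (B ∘L adjoint (coordIsometry e f φ)) := by
    rw [adjoint_comp, adjoint_adjoint, hT]
    rfl
  rw [h1]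
  refine (traceNorm_adjoint_comp_le f e _ _).trans ?_
  rw [key, key]
  calc _ ≤ 2⁻¹ * (traceNorm e T + traceNorm e T) := by gcongr
    _ = traceNorm e T := by
      rw [← two_mul, ← mul_assoc, ENNReal.inv_mul_cancel two_ne_zero ENNReal.ofNat_ne_top, one_mul]

/-- The compressions of an operator to disjoint sets of coordinates have trace norms that add up to
at most the trace norm of the operator. -/
theorem tsum_traceNorm_pullOp_le {J : Type*} (ψ : J → ι ↪ κ)
    (hψ : Function.Injective fun p : J × ι => ψ p.1 p.2) (T : K →L[ℂ] K) :
    ∑' k, traceNorm e (pullOp e f (ψ k) T) ≤ traceNorm f T := by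
  obtain ⟨A, B, hT, hA, hB⟩ := exists_adjoint_comp_eq f T
  have key : ∀ A : K →L[ℂ] K, ∑' k, ∑' i, ‖A (f (ψ k i))‖ₑ ^ 2 ≤ ∑' j, ‖A (f j)‖ₑ ^ 2 := by
    intro A
    rw [← ENNReal.tsum_prod]
    exact ENNReal.tsum_comp_le_tsum_of_injective hψ fun j => ‖A (f j)‖ₑ ^ 2
  calc ∑' k, traceNorm e (pullOp e f (ψ k) T)
      ≤ ∑' k, 2⁻¹ * (∑' i, ‖A (f (ψ k i))‖ₑ ^ 2 + ∑' i, ‖B (f (ψ k i))‖ₑ ^ 2) := by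
        refine ENNReal.tsum_le_tsum fun k => ?_
        have h1 : pullOp e f (ψ k) T = adjoint (A ∘L coordIsometry e f (ψ k)) ∘L
            (B ∘L coordIsometry e f (ψ k)) := by
          rw [adjoint_comp, hT]
          rfl
        rw [h1]
        refine (traceNorm_adjoint_comp_le e f _ _).trans_eq ?_
        simp only [comp_apply, coordIsometry_apply_basis]
    _ ≤ 2⁻¹ * (traceNorm f T + traceNorm f T) := by
        rw [ENNReal.tsum_mul_left, ENNReal.tsum_add]
        gcongr
        · exact (key A).trans hA
        · exact (key B).trans hB
    _ = traceNorm f T := by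
      rw [← two_mul, ← mul_assoc, ENNReal.inv_mul_cancel two_ne_zero ENNReal.ofNat_ne_top, one_mul]

theorem traceNorm_pullOp_le (T : K →L[ℂ] K) : traceNorm e (pullOp e f φ T) ≤ traceNorm f T := by
  have h := tsum_traceNorm_pullOp_le e f (fun _ : Unit => φ)
    (fun p q h => Prod.ext rfl (φ.injective h)) T
  simpa using h

end Trace

section AbsolutelySummable

open scoped NNReal

/-- The `ℓ¹`-sum of copies of `X` indexed by `K`. -/
abbrev L1 (K X : Type*) [NormedAddCommGroup X] := lp (fun _ : K => X) 1

variable {K K' X Y Z : Type*} [NormedAddCommGroup X] [NormedSpace ℂ X]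
  [NormedAddCommGroup Y] [NormedSpace ℂ Y] [NormedAddCommGroup Z] [NormedSpace ℂ Z]

theorem L1.enorm_eq_tsum (f : L1 K X) : ‖f‖ₑ = ∑' k, ‖f k‖ₑ := by
  have h := lp.hasSum_norm (p := 1) (by simp) f
  simp only [ENNReal.toReal_one, Real.rpow_one] at h
  have h2 := ENNReal.ofReal_tsum_of_nonneg (fun k => norm_nonneg (f k)) h.summable
  rw [h.tsum_eq] at h2
  simpa only [ofReal_norm] using h2

theorem memℓp_one_of_tsum_enorm_lt {f : K → X} (h : ∑' k, ‖f k‖ₑ < ∞) : Memℓp f 1 := by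
  refine memℓp_gen ?_
  simpa using tsum_enorm_ne_top_iff_summable_norm.1 h.ne

/-- A linear map with `‖L z‖ ≤ C ‖z‖`, as a continuous linear map. -/
noncomputable def clmOfBound (L : Z →ₗ[ℂ] Y) (C : ℝ≥0) (h : ∀ z, ‖L z‖ₑ ≤ C * ‖z‖ₑ) :
    Z →L[ℂ] Y :=
  L.mkContinuous C fun z => by
    have h1 := h z
    rw [enorm_eq_nnnorm, enorm_eq_nnnorm, ← ENNReal.coe_mul, ENNReal.coe_le_coe] at h1
    exact_mod_cast h1

/-- A bounded family of coordinates defines a continuous linear map into an `ℓ¹`-sum. -/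
noncomputable def L1.lift (L : Z →ₗ[ℂ] K → X) (C : ℝ≥0) (h : ∀ z, ∑' k, ‖L z k‖ₑ ≤ C * ‖z‖ₑ) :
    Z →L[ℂ] L1 K X :=
  clmOfBound
    { toFun := fun z => ⟨L z, memℓp_one_of_tsum_enorm_lt
        ((h z).trans_lt (ENNReal.mul_lt_top ENNReal.coe_lt_top enorm_lt_top))⟩
      map_add' := fun x y => Subtype.ext (map_add L x y)
      map_smul' := fun c x => Subtype.ext (map_smul L c x) } C fun z => by
    rw [L1.enorm_eq_tsum]
    exact h z

@[simp]
theorem L1.lift_apply (L : Z →ₗ[ℂ] K → X) (C : ℝ≥0) (h : ∀ z, ∑' k, ‖L z k‖ₑ ≤ C * ‖z‖ₑ)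
    (z : Z) (k : K) : L1.lift L C h z k = L z k := rfl

theorem enorm_fst_le (z : X × Y) : ‖z.1‖ₑ ≤ ‖z‖ₑ :=
  (enorm_le_iff_norm_le).2 (norm_fst_le z)

theorem enorm_snd_le (z : X × Y) : ‖z.2‖ₑ ≤ ‖z‖ₑ :=
  (enorm_le_iff_norm_le).2 (norm_snd_le z)

theorem enorm_clm_apply_le (A : X →L[ℂ] Y) (x : X) : ‖A x‖ₑ ≤ (‖A‖₊ : ℝ≥0∞) * ‖x‖ₑ :=
  A.le_opENorm x

/-- Apply a continuous linear map in each coordinate of an `ℓ¹`-sum. -/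
noncomputable def L1.map (K : Type*) (A : X →L[ℂ] Y) : L1 K X →L[ℂ] L1 K Y :=
  L1.lift
    { toFun := fun f k => A (f k)
      map_add' := fun f g => by ext k; simp
      map_smul' := fun c f => by ext k; simp } ‖A‖₊ fun f => by
    rw [L1.enorm_eq_tsum, ← ENNReal.tsum_mul_left]
    exact ENNReal.tsum_le_tsum fun k => enorm_clm_apply_le A (f k)

@[simp]
theorem L1.map_apply (A : X →L[ℂ] Y) (f : L1 K X) (k : K) : L1.map K A f k = A (f k) := rfl

/-- Restriction of an `ℓ¹`-sum along an injective map of indices. -/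
noncomputable def L1.comap (X : Type*) [NormedAddCommGroup X] [NormedSpace ℂ X] {g : K' → K}
    (hg : Function.Injective g) : L1 K X →L[ℂ] L1 K' X :=
  L1.lift
    { toFun := fun f k => f (g k)
      map_add' := fun f g => by ext k; simp
      map_smul' := fun c f => by ext k; simp } 1 fun f => by
    rw [L1.enorm_eq_tsum, ENNReal.coe_one, one_mul]
    exact ENNReal.tsum_comp_le_tsum_of_injective hg fun k => ‖f k‖ₑ

@[simp]
theorem L1.comap_apply {g : K' → K} (hg : Function.Injective g) (f : L1 K X) (k : K') :
    L1.comap X hg f k = f (g k) := rfl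

noncomputable def L1.congr (K : Type*) (A : X ≃L[ℂ] Y) : L1 K X ≃L[ℂ] L1 K Y :=
  .equivOfInverse (L1.map K (A : X →L[ℂ] Y)) (L1.map K (A.symm : Y →L[ℂ] X))
    (fun f => by ext k; simp) (fun f => by ext k; simp)

noncomputable def L1.prodEquiv (K X Y : Type*) [NormedAddCommGroup X] [NormedSpace ℂ X]
    [NormedAddCommGroup Y] [NormedSpace ℂ Y] : L1 K (X × Y) ≃L[ℂ] L1 K X × L1 K Y :=
  .equivOfInverse ((L1.map K (.fst ℂ X Y)).prod (L1.map K (.snd ℂ X Y)))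
    ((L1.map K (.inl ℂ X Y)).coprod (L1.map K (.inr ℂ X Y)))
    (fun f => by ext k <;> simp) (fun f => by ext k <;> simp)

/-- Split off the zeroth coordinate. -/
noncomputable def L1.consEquiv (X : Type*) [NormedAddCommGroup X] [NormedSpace ℂ X] :
    L1 ℕ X ≃L[ℂ] X × L1 ℕ X :=
  .equivOfInverse ((lp.evalCLM ℂ (fun _ : ℕ => X) 1 0).prod (L1.comap X Nat.succ_injective))
    (L1.lift
      { toFun := fun f k => Nat.casesOn k f.1 f.2
        map_add' := fun f g => by ext k; cases k <;> simp
        map_smul' := fun c f => by ext k; cases k <;> simp } 2 fun f => by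
      rw [tsum_eq_zero_add' ENNReal.summable]
      have h1 : ‖f.1‖ₑ ≤ ‖f‖ₑ := enorm_fst_le f
      have h2 : ‖f.2‖ₑ ≤ ‖f‖ₑ := enorm_snd_le f
      rw [L1.enorm_eq_tsum] at h2
      calc _ ≤ ‖f‖ₑ + ‖f‖ₑ := add_le_add h1 h2
        _ = _ := by rw [← two_mul]; rfl)
    (fun f => by ext k; cases k <;> rfl) (fun f => by
      refine Prod.ext rfl ?_
      ext k
      rfl)

noncomputable def L1.curryEquiv (X : Type*) [NormedAddCommGroup X] [NormedSpace ℂ X] :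
    L1 ℕ (L1 ℕ X) ≃L[ℂ] L1 ℕ X :=
  .equivOfInverse
    (L1.lift
      { toFun := fun f k => f k.unpair.1 k.unpair.2
        map_add' := fun f g => by ext k; simp
        map_smul' := fun c f => by ext k; simp } 1 fun f => by
      rw [L1.enorm_eq_tsum, ENNReal.coe_one, one_mul]
      simp only [L1.enorm_eq_tsum]
      rw [← ENNReal.tsum_prod (f := fun a b => ‖f a b‖ₑ), ← Nat.pairEquiv.symm.tsum_eq]
      rfl)
    (L1.lift
      { toFun := fun f n => L1.comap X
          (g := Nat.pair n) (fun a b h => (Nat.pair_eq_pair.1 h).2) f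
        map_add' := fun f g => by ext k; simp
        map_smul' := fun c f => by ext k; simp } 1 fun f => by
      rw [L1.enorm_eq_tsum, ENNReal.coe_one, one_mul]
      simp only [L1.enorm_eq_tsum]
      rw [← Nat.pairEquiv.tsum_eq (fun k => ‖f k‖ₑ)]
      exact (ENNReal.tsum_prod (f := fun a b => ‖f (Nat.pair a b)‖ₑ)).ge)
    (fun f => by
      ext n k
      change f (Nat.pair n k).unpair.1 (Nat.pair n k).unpair.2 = f n k
      rw [Nat.unpair_pair])
    (fun f => by
      ext k
      change f (Nat.pair k.unpair.1 k.unpair.2) = f k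
      rw [Nat.pair_unpair])

end AbsolutelySummable

section Factor

variable {X X' Y Y' Z : Type*} [NormedAddCommGroup X] [NormedSpace ℂ X]
  [NormedAddCommGroup Y] [NormedSpace ℂ Y] [NormedAddCommGroup Z] [NormedSpace ℂ Z]
  [NormedAddCommGroup X'] [NormedSpace ℂ X'] [NormedAddCommGroup Y'] [NormedSpace ℂ Y']

/-- `X` is isomorphic to a complemented subspace of `Y`. -/
def Factor (X Y : Type*) [NormedAddCommGroup X] [NormedSpace ℂ X]
    [NormedAddCommGroup Y] [NormedSpace ℂ Y] : Prop :=
  ∃ (i : X →L[ℂ] Y) (p : Y →L[ℂ] X), ∀ x, p (i x) = x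

theorem Factor.trans (h : Factor X Y) (h' : Factor Y Z) : Factor X Z := by
  obtain ⟨i, p, h⟩ := h
  obtain ⟨i', p', h'⟩ := h'
  exact ⟨i' ∘L i, p ∘L p', fun x => by simp [h, h']⟩

theorem Factor.prod (h : Factor X Y) (h' : Factor X' Y') : Factor (X × X') (Y × Y') := by
  obtain ⟨i, p, h⟩ := h
  obtain ⟨i', p', h'⟩ := h'
  exact ⟨i.prodMap i', p.prodMap p', fun x => Prod.ext (h x.1) (h' x.2)⟩

theorem factor_of_equiv (A : X ≃L[ℂ] Y) : Factor X Y :=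
  ⟨A, A.symm, fun x => by simp⟩

theorem factor_L1 (X : Type*) [NormedAddCommGroup X] [NormedSpace ℂ X] : Factor X (L1 ℕ X) :=
  Factor.trans ⟨.inl ℂ X (L1 ℕ X), .fst ℂ X (L1 ℕ X), fun x => by simp⟩
    (factor_of_equiv (L1.consEquiv X).symm)

theorem factor_prod_self_L1 (X : Type*) [NormedAddCommGroup X] [NormedSpace ℂ X] :
    Factor (X × X) (L1 ℕ X) := by
  refine Factor.trans ?_ (factor_of_equiv (L1.consEquiv X).symm)
  exact Factor.prod (factor_of_equiv (.refl ℂ X)) (factor_L1 X)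

theorem Factor.exists_prod_equiv (h : Factor X Y) :
    ∃ W : Submodule ℂ Y, Nonempty (Y ≃L[ℂ] X × W) := by
  obtain ⟨i, p, h⟩ := h
  exact ⟨p.ker, ⟨.equivOfRightInverse p i h⟩⟩

/-- Pełczyński's decomposition method. -/
theorem nonempty_equiv_L1 (h : Factor X (L1 ℕ Y)) (h' : Factor (L1 ℕ Y) X) :
    Nonempty (X ≃L[ℂ] L1 ℕ Y) := by
  obtain ⟨W, ⟨a⟩⟩ := h.exists_prod_equiv
  obtain ⟨Z, ⟨b⟩⟩ := h'.exists_prod_equiv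
  let L := L1 ℕ Y
  have c : L1 ℕ L ≃L[ℂ] L := L1.curryEquiv Y
  have d : L ≃L[ℂ] (L × L) := c.symm.trans ((L1.consEquiv L).trans ((.refl ℂ L : L ≃L[ℂ] L).prodCongr c))
  have s : L ≃L[ℂ] (L1 ℕ X × L1 ℕ W) :=
    c.symm.trans ((L1.congr ℕ a).trans (L1.prodEquiv ℕ X W))
  have u : X ≃L[ℂ] (L × X) := b.trans ((d.prodCongr (.refl ℂ Z)).trans
    ((ContinuousLinearEquiv.prodAssoc ℂ L L Z).trans ((ContinuousLinearEquiv.refl ℂ L).prodCongr b.symm)))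
  have v : (L × X) ≃L[ℂ] L := (ContinuousLinearEquiv.prodComm ℂ L X).trans
    (((ContinuousLinearEquiv.refl ℂ X).prodCongr s).trans
      ((ContinuousLinearEquiv.prodAssoc ℂ X (L1 ℕ X) (L1 ℕ W)).symm.trans
        (((L1.consEquiv X).symm.prodCongr (.refl ℂ (L1 ℕ W))).trans s.symm)))
  exact ⟨u.trans v⟩

end Factor

open scoped NNReal

section Diagonal

variable {ι κ H K Z J : Type*} [NormedAddCommGroup H] [InnerProductSpace ℂ H] [CompleteSpace H]
  [NormedAddCommGroup K] [InnerProductSpace ℂ K] [CompleteSpace K] [Preorder ι] [Preorder κ]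
  [NormedAddCommGroup Z] [NormedSpace ℂ Z]

namespace NestAlgebraC1

theorem enorm_eq (e : HilbertBasis ι ℂ H) (T : NestAlgebraC1 e) :
    ‖T‖ₑ = traceNorm e (toOp e T) := by
  rw [← ofReal_norm]
  exact ENNReal.ofReal_toReal (traceNorm_ne_top e T)

theorem inner_eq_zero (e : HilbertBasis ι ℂ H) (T : NestAlgebraC1 e) {i j : ι} (h : ¬ i ≤ j) :
    ⟪e i, toOp e T (e j)⟫_ℂ = 0 :=
  (mem_nestAlgebra_iff e).1 (Submodule.mem_inf.1 T.2).1 i j h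

theorem ext_inner (e : HilbertBasis ι ℂ H) {S T : NestAlgebraC1 e}
    (h : ∀ i j, ⟪e i, toOp e S (e j)⟫_ℂ = ⟪e i, toOp e T (e j)⟫_ℂ) : S = T :=
  Subtype.ext (ext_inner_basis e h)

/-- A linear map with values in the upper triangular operators, bounded in the trace norm. -/
noncomputable def lift (e : HilbertBasis ι ℂ H) (L : Z →ₗ[ℂ] (H →L[ℂ] H)) (C : ℝ≥0)
    (h : ∀ z, traceNorm e (L z) ≤ C * ‖z‖ₑ)
    (hL : ∀ z i j, ¬ i ≤ j → ⟪e i, L z (e j)⟫_ℂ = 0) : Z →L[ℂ] NestAlgebraC1 e :=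
  clmOfBound (Y := NestAlgebraC1 e)
    (LinearMap.codRestrict (nestAlgebra e ⊓ traceClass e) L fun z =>
      Submodule.mem_inf.2 ⟨(mem_nestAlgebra_iff e).2 (hL z),
        (h z).trans_lt (ENNReal.mul_lt_top ENNReal.coe_lt_top enorm_lt_top)⟩) C fun z => by
    rw [enorm_eq]
    exact h z

end NestAlgebraC1

open NestAlgebraC1

variable (e : HilbertBasis ι ℂ H) (f : HilbertBasis κ ℂ K)

/-- The compression along an order embedding of the index sets. -/
noncomputable def pullCLM (φ : ι ↪o κ) : NestAlgebraC1 f →L[ℂ] NestAlgebraC1 e :=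
  lift e (pullOp e f φ.toEmbedding ∘ₗ toOp f) 1
    (fun T => by
      rw [ENNReal.coe_one, one_mul, enorm_eq]
      exact traceNorm_pullOp_le e f φ.toEmbedding _)
    (fun T i j hij => by
      rw [LinearMap.comp_apply, inner_pullOp]
      exact inner_eq_zero f T fun h => hij (φ.le_iff_le.1 h))

theorem inner_pullCLM (φ : ι ↪o κ) (T : NestAlgebraC1 f) (i j : ι) :
    ⟪e i, toOp e (pullCLM e f φ T) (e j)⟫_ℂ = ⟪f (φ i), toOp f T (f (φ j))⟫_ℂ :=
  inner_pullOp e f φ.toEmbedding (toOp f T) i j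

variable (ψ : J → ι ↪o κ) (hψ : Function.Injective fun p : J × ι => ψ p.1 p.2)

include hψ in
theorem range_disjoint {j k : J} (hjk : j ≠ k) (i : ι) : ψ j i ∉ Set.range (ψ k) := by
  rintro ⟨i', h⟩
  exact hjk (congrArg Prod.fst (@hψ (k, i') (j, i) h)).symm

/-- The diagonal blocks of an operator with respect to disjoint copies of `ι` in `κ`. -/
noncomputable def diagPull : NestAlgebraC1 f →L[ℂ] L1 J (NestAlgebraC1 e) :=
  L1.lift (LinearMap.pi fun k => (pullCLM e f (ψ k) : NestAlgebraC1 f →ₗ[ℂ] NestAlgebraC1 e)) 1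
    fun T => by
      rw [ENNReal.coe_one, one_mul, enorm_eq]
      simp only [enorm_eq]
      exact tsum_traceNorm_pullOp_le e f (fun k => (ψ k).toEmbedding) hψ (toOp f T)

theorem diagPull_apply (T : NestAlgebraC1 f) (k : J) :
    diagPull e f ψ hψ T k = pullCLM e f (ψ k) T := rfl

/-- The summands of the block diagonal operator with prescribed blocks. -/
noncomputable def diagSummands : L1 J (NestAlgebraC1 e) →L[ℂ] L1 J (K →L[ℂ] K) :=
  L1.lift
    { toFun := fun z k => pushOp e f (ψ k).toEmbedding (toOp e (z k))
      map_add' := fun y z => by ext1 k; simp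
      map_smul' := fun c z => by ext1 k; simp } 1 fun z => by
    rw [ENNReal.coe_one, one_mul, L1.enorm_eq_tsum]
    refine ENNReal.tsum_le_tsum fun k => ?_
    rw [enorm_eq]
    exact (enorm_le_traceNorm f _).trans (traceNorm_pushOp_le e f _ _)

/-- The block diagonal operator with prescribed blocks. -/
noncomputable def diagOp : L1 J (NestAlgebraC1 e) →L[ℂ] (K →L[ℂ] K) :=
  lp.tsumCLM ℂ J (K →L[ℂ] K) ∘L diagSummands e f ψ

theorem hasSum_diagOp (z : L1 J (NestAlgebraC1 e)) :
    HasSum (fun k => pushOp e f (ψ k).toEmbedding (toOp e (z k))) (diagOp e f ψ z) := by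
  have h := lp.hasSum_norm (p := 1) (by simp) (diagSummands e f ψ z)
  simp only [ENNReal.toReal_one, Real.rpow_one] at h
  exact h.summable.of_norm.hasSum

theorem hasSum_diagOp_apply (z : L1 J (NestAlgebraC1 e)) (x : K) :
    HasSum (fun k => pushOp e f (ψ k).toEmbedding (toOp e (z k)) x) (diagOp e f ψ z x) :=
  (hasSum_diagOp e f ψ z).mapL (ContinuousLinearMap.apply ℂ K x)

theorem hasSum_inner_diagOp (z : L1 J (NestAlgebraC1 e)) (a b : κ) :
    HasSum (fun k => ⟪f a, pushOp e f (ψ k).toEmbedding (toOp e (z k)) (f b)⟫_ℂ)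
      ⟪f a, diagOp e f ψ z (f b)⟫_ℂ :=
  (hasSum_diagOp_apply e f ψ z (f b)).mapL (innerSL ℂ (f a))

include hψ in
theorem inner_diagOp (z : L1 J (NestAlgebraC1 e)) (k : J) (i j : ι) :
    ⟪f (ψ k i), diagOp e f ψ z (f (ψ k j))⟫_ℂ = ⟪e i, toOp e (z k) (e j)⟫_ℂ := by
  have h := hasSum_inner_diagOp e f ψ z (ψ k i) (ψ k j)
  refine (h.unique (hasSum_single k fun l hl => ?_)).trans
    (inner_pushOp e f (ψ k).toEmbedding (toOp e (z k)) i j)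
  exact inner_pushOp_of_notMem e f _ _ (Or.inl (range_disjoint ψ hψ hl.symm i))

theorem inner_diagOp_of_notMem (z : L1 J (NestAlgebraC1 e)) {a b : κ}
    (h : ∀ k, a ∉ Set.range (ψ k) ∨ b ∉ Set.range (ψ k)) :
    ⟪f a, diagOp e f ψ z (f b)⟫_ℂ = 0 := by
  refine (hasSum_inner_diagOp e f ψ z a b).unique ?_
  convert hasSum_zero using 2 with k
  exact inner_pushOp_of_notMem e f _ _ (h k)

/-- The block diagonal operator with prescribed blocks, as an element of the nest algebra. -/
noncomputable def diagPush : L1 J (NestAlgebraC1 e) →L[ℂ] NestAlgebraC1 f :=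
  lift f (diagOp e f ψ : L1 J (NestAlgebraC1 e) →ₗ[ℂ] (K →L[ℂ] K)) 1
    (fun z => by
      rw [ENNReal.coe_one, one_mul, L1.enorm_eq_tsum]
      refine (traceNorm_le_tsum f fun b => hasSum_diagOp_apply e f ψ z (f b)).trans ?_
      refine ENNReal.tsum_le_tsum fun k => ?_
      rw [enorm_eq]
      exact traceNorm_pushOp_le e f _ _)
    (fun z a b hab => by
      by_cases h : ∃ k, a ∈ Set.range (ψ k) ∧ b ∈ Set.range (ψ k)
      · obtain ⟨k, ⟨i, rfl⟩, ⟨j, rfl⟩⟩ := h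
        exact (inner_diagOp e f ψ hψ z k i j).trans
          (inner_eq_zero e (z k) fun h => hab ((ψ k).le_iff_le.2 h))
      · refine inner_diagOp_of_notMem e f ψ z fun k => ?_
        by_contra! hk
        exact h ⟨k, hk⟩)

theorem diagPull_diagPush (z : L1 J (NestAlgebraC1 e)) :
    diagPull e f ψ hψ (diagPush e f ψ hψ z) = z := by
  ext1
  funext k
  refine ext_inner e fun i j => ?_
  rw [diagPull_apply, inner_pullCLM]
  exact inner_diagOp e f ψ hψ z k i j

include hψ in
/-- Disjoint copies of `ι` in `κ` yield a complemented `ℓ¹`-sum of nest algebras. -/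
theorem factor_L1_of_disjoint : Factor (L1 J (NestAlgebraC1 e)) (NestAlgebraC1 f) :=
  ⟨diagPush e f ψ hψ, diagPull e f ψ hψ, diagPull_diagPush e f ψ hψ⟩

theorem factor_of_orderEmbedding (φ : ι ↪o κ) :
    Factor (NestAlgebraC1 e) (NestAlgebraC1 f) := by
  refine ⟨lift f (pushOp e f φ.toEmbedding ∘ₗ toOp e) 1 (fun T => ?_) (fun T a b hab => ?_),
    pullCLM e f φ, fun T => ?_⟩
  · rw [ENNReal.coe_one, one_mul, enorm_eq]
    exact traceNorm_pushOp_le e f _ _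
  · by_cases h : a ∈ Set.range φ ∧ b ∈ Set.range φ
    · obtain ⟨⟨i, rfl⟩, ⟨j, rfl⟩⟩ := h
      exact (inner_pushOp e f φ.toEmbedding (toOp e T) i j).trans
        (inner_eq_zero e T fun h => hab (φ.le_iff_le.2 h))
    · refine inner_pushOp_of_notMem e f φ.toEmbedding (toOp e T) ?_
      rw [not_and_or] at h
      exact h
  · refine ext_inner e fun i j => ?_
    rw [inner_pullCLM]
    exact inner_pushOp e f φ.toEmbedding (toOp e T) i j

end Diagonal

section Lexicographic

open NestAlgebraC1

variable {J A B H K L M : Type*} [PartialOrder J] [Preorder A] [Preorder B]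
  [NormedAddCommGroup H] [InnerProductSpace ℂ H] [CompleteSpace H]
  [NormedAddCommGroup K] [InnerProductSpace ℂ K] [CompleteSpace K]
  [NormedAddCommGroup L] [InnerProductSpace ℂ L] [CompleteSpace L]
  [NormedAddCommGroup M] [InnerProductSpace ℂ M] [CompleteSpace M]

/-- The copy of `A` at the position `j` of the lexicographic product `J ×ₗ A`. -/
def lexFiber (A : Type*) [Preorder A] (j : J) : A ↪o J ×ₗ A where
  toFun a := toLex (j, a)
  inj' a b h := congrArg Prod.snd (toLex.injective h)
  map_rel_iff' {a b} := by
    change toLex (j, a) ≤ toLex (j, b) ↔ a ≤ b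
    simp [Prod.Lex.toLex_le_toLex]

theorem lexFiber_injective : Function.Injective fun p : J × A => lexFiber A p.1 p.2 :=
  fun _ _ h => toLex.injective h

variable (e : HilbertBasis A ℂ H) (f : HilbertBasis (J ×ₗ A) ℂ K)
  (f' : HilbertBasis (J ×ₗ B) ℂ M)

/-- The projection that removes the diagonal blocks. -/
noncomputable def offDiag : NestAlgebraC1 f →L[ℂ] NestAlgebraC1 f :=
  .id ℂ _ - diagPush e f (lexFiber A) lexFiber_injective ∘L
    diagPull e f (lexFiber A) lexFiber_injective

theorem inner_offDiag_self (T : NestAlgebraC1 f) (j : J) (a b : A) :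
    ⟪f (toLex (j, a)), toOp f (offDiag e f T) (f (toLex (j, b)))⟫_ℂ = 0 := by
  have h := (inner_diagOp e f (lexFiber A) lexFiber_injective
    (diagPull e f (lexFiber A) lexFiber_injective T) j a b).trans
    (inner_pullCLM e f (lexFiber A j) T a b)
  rw [offDiag, sub_apply, map_sub, sub_apply,
    inner_sub_right]
  exact sub_eq_zero.2 h.symm

theorem inner_offDiag_of_ne (T : NestAlgebraC1 f) {j k : J} (hjk : j ≠ k) (a b : A) :
    ⟪f (toLex (j, a)), toOp f (offDiag e f T) (f (toLex (k, b)))⟫_ℂ =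
      ⟪f (toLex (j, a)), toOp f T (f (toLex (k, b)))⟫_ℂ := by
  have h : ⟪f (toLex (j, a)), diagOp e f (lexFiber A)
      (diagPull e f (lexFiber A) lexFiber_injective T) (f (toLex (k, b)))⟫_ℂ = 0 := by
    refine inner_diagOp_of_notMem e f _ _ fun l => ?_
    by_contra! hl
    obtain ⟨⟨a', ha⟩, ⟨b', hb⟩⟩ := hl
    have h1 : l = j := congrArg Prod.fst (toLex.injective ha)
    have h2 : l = k := congrArg Prod.fst (toLex.injective hb)
    exact hjk (h1.symm.trans h2)
  rw [offDiag, sub_apply, map_sub, sub_apply,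
    inner_sub_right]
  exact (congrArg _ h).trans (sub_zero _)

theorem inner_offDiag_eq_zero (T : NestAlgebraC1 f) {j k : J} (hjk : ¬ j < k) (a b : A) :
    ⟪f (toLex (j, a)), toOp f (offDiag e f T) (f (toLex (k, b)))⟫_ℂ = 0 := by
  by_cases h : j = k
  · subst h
    exact inner_offDiag_self e f T j a b
  · rw [inner_offDiag_of_ne e f T h]
    refine inner_eq_zero f T fun hle => ?_
    rcases Prod.Lex.toLex_le_toLex.1 hle with h1 | h1
    · exact hjk h1
    · exact h h1.1

/-- The fibrewise extension of an injection to lexicographic products. -/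
def lexMap (J : Type*) (g : A ↪ B) : J ×ₗ A ↪ J ×ₗ B where
  toFun x := toLex ((ofLex x).1, g (ofLex x).2)
  inj' x y h := by
    have h1 := toLex.injective h
    simp only [Prod.mk.injEq, EmbeddingLike.apply_eq_iff_eq] at h1
    exact ofLex.injective (Prod.ext h1.1 h1.2)

theorem not_lt_of_not_le {x y : J ×ₗ A} (h : ¬ x ≤ y) : ¬ (ofLex x).1 < (ofLex y).1 :=
  fun hlt => h (Prod.Lex.le_iff.2 (Or.inl hlt))

/-- Only the diagonal blocks of the nest algebra of `J ×ₗ A` depend on the order of `A`. -/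
theorem factor_lex (e' : HilbertBasis B ℂ L) (g : A ↪ B) :
    Factor (NestAlgebraC1 f) (L1 J (NestAlgebraC1 e) × NestAlgebraC1 f') := by
  let P : NestAlgebraC1 f →L[ℂ] NestAlgebraC1 f' :=
    lift f' (pushOp f f' (lexMap J g) ∘ₗ toOp f ∘ₗ (offDiag e f).toLinearMap) ‖offDiag e f‖₊
      (fun T => by
        refine (traceNorm_pushOp_le f f' (lexMap J g) _).trans ?_
        refine le_trans (le_of_eq ?_) (enorm_clm_apply_le (offDiag e f) T)
        rw [enorm_eq]
        rfl)
      (fun T x y hxy => by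
        by_cases h : x ∈ Set.range (lexMap J g) ∧ y ∈ Set.range (lexMap J g)
        · obtain ⟨⟨a, rfl⟩, ⟨b, rfl⟩⟩ := h
          exact (inner_pushOp f f' (lexMap J g) _ a b).trans
            (inner_offDiag_eq_zero e f T (not_lt_of_not_le hxy) _ _)
        · refine inner_pushOp_of_notMem f f' (lexMap J g) _ ?_
          rw [not_and_or] at h
          exact h)
  let Q : NestAlgebraC1 f' →L[ℂ] NestAlgebraC1 f :=
    lift f (pullOp f f' (lexMap J g) ∘ₗ toOp f' ∘ₗ (offDiag e' f').toLinearMap) ‖offDiag e' f'‖₊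
      (fun T => by
        refine (traceNorm_pullOp_le f f' (lexMap J g) _).trans ?_
        refine le_trans (le_of_eq ?_) (enorm_clm_apply_le (offDiag e' f') T)
        rw [enorm_eq]
        rfl)
      (fun T x y hxy => (inner_pullOp f f' (lexMap J g) _ x y).trans
        (inner_offDiag_eq_zero e' f' T (not_lt_of_not_le hxy) _ _))
  have hQP : ∀ T, Q (P T) = offDiag e f T := by
    intro T
    refine ext_inner f fun x y => ?_
    have h1 : ⟪f x, toOp f (Q (P T)) (f y)⟫_ℂ =
      ⟪f' (lexMap J g x), toOp f' (offDiag e' f' (P T)) (f' (lexMap J g y))⟫_ℂ :=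
      inner_pullOp f f' (lexMap J g) _ x y
    rw [h1]
    by_cases h : (ofLex x).1 < (ofLex y).1
    · refine (inner_offDiag_of_ne e' f' (P T) h.ne _ _).trans ?_
      exact inner_pushOp f f' (lexMap J g) _ x y
    · exact (inner_offDiag_eq_zero e' f' (P T) h _ _).trans
        (inner_offDiag_eq_zero e f T h _ _).symm
  refine ⟨(diagPull e f (lexFiber A) lexFiber_injective).prod P,
    (diagPush e f (lexFiber A) lexFiber_injective).coprod Q, fun T => ?_⟩
  rw [ContinuousLinearMap.prod_apply, ContinuousLinearMap.coprod_apply, hQP]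
  exact add_sub_cancel _ _

end Lexicographic

section Ordinals

open Ordinal Cardinal

universe u

/-- The nest algebra in the trace class of the ordinals below `a`. -/
abbrev NestBelow (a : Ordinal.{u}) : Type _ := NestAlgebraC1 (stdBasis (Set.Iio a))

theorem countable_Iio_iff {a : Ordinal.{u}} : Countable (Set.Iio a) ↔ a < ω₁ := by
  rw [← Cardinal.mk_le_aleph0_iff, Cardinal.mk_Iio_ordinal, Cardinal.lift_le_aleph0,
    ← Cardinal.ord_aleph, Cardinal.lt_ord, ← Cardinal.succ_aleph0, Order.lt_succ_iff]

theorem omega0_opow_lt_omega_one {a : Ordinal.{u}} (ha : a < ω₁) : ω ^ a < ω₁ := by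
  rw [← Cardinal.ord_aleph, Cardinal.lt_ord, ← Cardinal.succ_aleph0, Order.lt_succ_iff] at ha ⊢
  exact (card_opow_le _ _).trans (by simp [ha])

/-- Euclidean division embeds the ordinals below `a * b` into a lexicographic product. -/
noncomputable def divModEmbedding (a b : Ordinal.{u}) (ha : a ≠ 0) :
    Set.Iio (a * b) ↪o Set.Iio b ×ₗ Set.Iio a :=
  OrderEmbedding.ofStrictMono
    (fun x => toLex (⟨x.1 / a, (lt_mul_iff_div_lt ha).1 x.2⟩, ⟨x.1 % a, mod_lt _ ha⟩))
    (by
      intro x y hxy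
      rw [Prod.Lex.toLex_lt_toLex]
      rcases (div_le_left (Subtype.coe_lt_coe.2 hxy).le a).lt_or_eq with h | h
      · exact Or.inl h
      · refine Or.inr ⟨Subtype.ext h, ?_⟩
        have h1 : x.1 < y.1 := hxy
        rw [← div_add_mod x.1 a, ← div_add_mod y.1 a, h] at h1
        exact Subtype.coe_lt_coe.1 (lt_of_add_lt_add_left h1 : x.1 % a < y.1 % a))

noncomputable def mulAddEmbedding (b : Ordinal.{u}) :
    Set.Iio b ×ₗ ℕ ↪o Set.Iio (ω * b) :=
  OrderEmbedding.ofStrictMono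
    (fun x => ⟨ω * (ofLex x).1.1 + (ofLex x).2,
      lt_mul_iff.2 ⟨_, (ofLex x).1.2, _, natCast_lt_omega0 _, rfl⟩⟩)
    (by
      intro x y hxy
      change ω * (ofLex x).1.1 + (ofLex x).2 < ω * (ofLex y).1.1 + (ofLex y).2
      rcases Prod.Lex.lt_iff.1 hxy with h | ⟨h, h'⟩
      · have h1 : Order.succ (ofLex x).1.1 ≤ (ofLex y).1.1 := Order.succ_le_of_lt h
        calc ω * (ofLex x).1.1 + (ofLex x).2 < ω * (ofLex x).1.1 + ω := by
              gcongr; exact natCast_lt_omega0 _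
          _ = ω * Order.succ (ofLex x).1.1 := (mul_succ _ _).symm
          _ ≤ ω * (ofLex y).1.1 := by gcongr
          _ ≤ _ := le_self_add
      · rw [h]
        gcongr)

/-- The ordinals below `ω * b` contain infinitely many disjoint copies of themselves. -/
theorem factor_L1_omega0_mul (J : Type*) [Countable J] (b : Ordinal.{u}) :
    Factor (L1 J (NestBelow (ω * b))) (NestBelow (ω * b)) := by
  obtain ⟨h, hh⟩ := exists_injective_nat J
  have hN : ∀ x : Set.Iio (ω : Ordinal.{u}), ∃ n : ℕ, x.1 = n := fun x => lt_omega0.1 x.2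
  choose N hN using hN
  let G : J → Set.Iio b ×ₗ Set.Iio (ω : Ordinal.{u}) ↪o Set.Iio b ×ₗ ℕ := fun k =>
    OrderEmbedding.ofStrictMono
      (fun x => toLex ((ofLex x).1, Nat.pair (h k) (N (ofLex x).2)))
      (by
        intro x y hxy
        rw [Prod.Lex.toLex_lt_toLex]
        rcases Prod.Lex.lt_iff.1 hxy with hlt | ⟨heq, hlt⟩
        · exact Or.inl hlt
        · refine Or.inr ⟨heq, Nat.pair_lt_pair_right _ ?_⟩
          rw [← Subtype.coe_lt_coe, hN, hN] at hlt
          exact_mod_cast hlt)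
  refine factor_L1_of_disjoint _ _ (fun k => (divModEmbedding ω b omega0_ne_zero).trans
    ((G k).trans (mulAddEmbedding b))) ?_
  rintro ⟨k, x⟩ ⟨l, y⟩ hxy
  have h1 : G k (divModEmbedding ω b omega0_ne_zero x) = G l (divModEmbedding ω b omega0_ne_zero y) :=
    (mulAddEmbedding b).injective hxy
  have h2 : h k = h l := (Nat.pair_eq_pair.1 (congrArg (fun z => (ofLex z).2) h1)).1
  obtain rfl := hh h2
  exact Prod.ext rfl ((divModEmbedding ω b omega0_ne_zero).injective ((G k).injective h1))

theorem factor_nestBelow {a b : Ordinal.{u}} (h : a ≤ b) : Factor (NestBelow a) (NestBelow b) :=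
  factor_of_orderEmbedding _ _
    (OrderEmbedding.ofStrictMono (fun x => ⟨x.1, x.2.trans_le h⟩) fun _ _ h => h)

theorem factor_nestBelow_T1 {a b : Ordinal.{u}} (h : a ≤ b) : Factor (NestBelow a) (T1 b) :=
  factor_of_orderEmbedding _ _
    (OrderEmbedding.ofStrictMono (fun x => ⟨x.1, (x.2.trans_le h).le⟩) fun _ _ h => h)

theorem factor_T1_nestBelow {a b : Ordinal.{u}} (h : a < b) : Factor (T1 a) (NestBelow b) :=
  factor_of_orderEmbedding _ _
    (OrderEmbedding.ofStrictMono (fun x => ⟨x.1, x.2.trans_lt h⟩) fun _ _ h => h)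

theorem factor_T1_T1 {a b : Ordinal.{u}} (h : a ≤ b) : Factor (T1 a) (T1 b) :=
  factor_of_orderEmbedding _ _
    (OrderEmbedding.ofStrictMono (fun x => ⟨x.1, x.2.trans h⟩) fun _ _ h => h)

theorem factor_nestBelow_mul {a b : Ordinal.{u}} (ha : a ≠ 0) (ha' : a < ω₁) :
    Factor (NestBelow (a * b)) (L1 (Set.Iio b) (NestBelow a) × NestBelow (ω * b)) := by
  have := countable_Iio_iff.2 ha'
  obtain ⟨g, hg⟩ := exists_injective_nat (Set.Iio a)
  refine (factor_of_orderEmbedding _ (stdBasis (Set.Iio b ×ₗ Set.Iio a))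
    (divModEmbedding a b ha)).trans ?_
  refine (factor_lex (stdBasis (Set.Iio a)) _ (stdBasis (Set.Iio b ×ₗ ℕ))
    (stdBasis ℕ) ⟨g, hg⟩).trans ?_
  exact Factor.prod (factor_of_equiv (.refl ℂ _))
    (factor_of_orderEmbedding _ _ (mulAddEmbedding b))

theorem one_add_lt_add {d c : Ordinal.{u}} (hd : 2 ≤ d) (hc : c < d * ω) : 1 + c < d + c := by
  rcases lt_or_ge c ω with h | h
  · obtain ⟨n, rfl⟩ := lt_omega0.1 h
    refine lt_of_lt_of_le ?_ (add_le_add_left hd (n : Ordinal.{u}))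
    have : 1 + n < 2 + n := by omega
    exact_mod_cast this
  · rw [one_add_of_omega0_le h]
    refine (le_add_self : c ≤ d + c).lt_of_ne fun h1 => hc.not_ge ?_
    exact add_eq_right_iff_mul_omega0_le.1 h1.symm

theorem factor_omega0_opow {d : Ordinal.{u}} (hd : 2 ≤ d) (c : Ordinal.{u}) (hc : c < d * ω)
    (hc' : c < ω₁) : Factor (NestBelow (ω ^ c)) (NestBelow (ω ^ d)) := by
  induction c using WellFoundedLT.induction with
  | ind c ih =>
  rcases le_or_gt c d with h | h
  · exact factor_nestBelow (opow_le_opow_right omega0_pos h)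
  obtain ⟨b, rfl⟩ := exists_add_of_le h.le
  have hb : b ≤ d + b := le_add_self
  have hb' : b < d * ω := hb.trans_lt hc
  have hlt := one_add_lt_add hd hb'
  have hd' : d < ω₁ := h.trans hc'
  obtain ⟨d', hd1⟩ := exists_add_of_le ((one_le_two (α := Ordinal.{u})).trans hd)
  have hL : ∀ (J : Type (u + 1)) [Countable J],
      Factor (L1 J (NestBelow (ω ^ d))) (NestBelow (ω ^ d)) := by
    intro J _
    rw [hd1, opow_one_add]
    exact factor_L1_omega0_mul J _
  have : Countable (Set.Iio (ω ^ b)) :=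
    countable_Iio_iff.2 (omega0_opow_lt_omega_one (hb.trans_lt hc'))
  have h2 := ih _ hlt (hlt.trans hc) (hlt.trans hc')
  rw [opow_one_add] at h2
  rw [opow_add]
  refine (factor_nestBelow_mul (opow_ne_zero _ omega0_ne_zero)
    (omega0_opow_lt_omega_one hd')).trans ?_
  refine ((hL _).prod h2).trans ((factor_prod_self_L1 _).trans ?_)
  rw [hd1, opow_one_add]
  exact factor_L1_omega0_mul ℕ _

theorem exists_lt_omega0_opow {a b : Ordinal.{u}} (ha : ω ^ (2 : Ordinal) ≤ a) (h : b < a ^ ω) :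
    ∃ d c, 2 ≤ d ∧ ω ^ d ≤ a ∧ c < d * ω ∧ b < ω ^ c ∧ (b < ω₁ → c < ω₁) := by
  have ha0 : a ≠ 0 := fun h0 => (opow_pos 2 omega0_pos).not_ge (h0 ▸ ha)
  have hd : 2 ≤ log ω a := le_log_of_opow_le one_lt_omega0 ha
  refine ⟨log ω a, Order.succ (log ω b), hd, opow_log_le_self _ ha0, ?_,
    lt_opow_succ_log_self one_lt_omega0 b, fun hb => ?_⟩
  · set d := log ω a with hd'
    obtain ⟨n, hn, hbn⟩ := (lt_opow_of_isSuccLimit ha0 isSuccLimit_omega0).1 h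
    obtain ⟨n, rfl⟩ := lt_omega0.1 hn
    have h1 : b < ω ^ (Order.succ d * Order.succ (n : Ordinal.{u})) := by
      rw [opow_mul]
      refine hbn.trans_le ((opow_le_opow_left _ (lt_opow_succ_log_self one_lt_omega0 a).le).trans ?_)
      exact opow_le_opow_right (opow_pos _ omega0_pos) (Order.le_succ _)
    have h2 : log ω b < Order.succ d * Order.succ (n : Ordinal.{u}) :=
      lt_log_of_lt_opow (by simp) h1
    have h3 : Order.succ d ≤ d * 2 := by
      rw [← one_add_one_eq_two, mul_add, mul_one, Order.succ_eq_add_one]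
      gcongr
      exact one_le_two.trans hd
    have h4 : (2 : Ordinal.{u}) * Order.succ (n : Ordinal.{u}) < ω := by
      have := natCast_lt_omega0.{u} (2 * (n + 1))
      rw [Order.succ_eq_add_one]
      exact_mod_cast this
    calc Order.succ (log ω b) ≤ Order.succ d * Order.succ (n : Ordinal.{u}) := Order.succ_le_of_lt h2
      _ ≤ d * 2 * Order.succ (n : Ordinal.{u}) := by gcongr
      _ = d * (2 * Order.succ (n : Ordinal.{u})) := mul_assoc _ _ _
      _ < d * ω := by
        gcongr
  · exact (isSuccLimit_omega 1).succ_lt ((log_le_self _ _).trans_lt hb)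

/-- Countable ordinals `ω ^ 2 ≤ a ≤ b < a ^ ω` have isomorphic nest algebras in the trace class. -/
theorem nonempty_T1_equiv {a b : Ordinal.{u}} (hb : b < ω₁) (ha : ω ^ (2 : Ordinal) ≤ a)
    (hab : a ≤ b) (hba : b < a ^ ω) : Nonempty (T1 a ≃L[ℂ] T1 b) := by
  obtain ⟨d, c, hd, hda, hc, hbc, hc'⟩ := exists_lt_omega0_opow ha hba
  obtain ⟨d', hd1⟩ := exists_add_of_le ((one_le_two (α := Ordinal)).trans hd)
  have h1 : Factor (L1 ℕ (NestBelow (ω ^ d))) (NestBelow (ω ^ d)) := by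
    rw [hd1, Ordinal.opow_one_add]
    exact factor_L1_omega0_mul ℕ _
  have h2 : Factor (T1 b) (NestBelow (ω ^ d)) :=
    (factor_T1_nestBelow hbc).trans (factor_omega0_opow hd c hc (hc' hb))
  have h3 : Factor (NestBelow (ω ^ d)) (T1 a) := factor_nestBelow_T1 hda
  have h4 : Factor (T1 a) (T1 b) := factor_T1_T1 hab
  have h5 := factor_L1 (NestBelow (ω ^ d))
  obtain ⟨A⟩ := nonempty_equiv_L1 ((h4.trans h2).trans h5) (h1.trans h3)
  obtain ⟨B⟩ := nonempty_equiv_L1 (h2.trans h5) (h1.trans (h3.trans h4))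
  exact ⟨A.trans B.symm⟩

end Ordinals

end NestC1

theorem proposition7 (α β : Ordinal) (hα : α < ω₁) (hβ : β < ω₁)
    (hωα : ω ^ (2 : Ordinal) ≤ α) (hαβ : α ≤ β) (hβα : β < α ^ ω) :
    Nonempty (NestC1.T1 α ≃L[ℂ] NestC1.T1 β) :=
  NestC1.nonempty_T1_equiv hβ hωα hαβ hβα
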